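/- Let $K\ge 0$ and $N\ge 1$ be integers, $X=\mathbb{R}^K$ with the Euclidean norm, $I=\{1,\dots,N\}$, and let $\Phi_j\in\mathcal{C}^1(X;\mathbb{R})$, $j\in I$, have gradients that are Lipschitz with a common constant $L$. Put $\bar\Phi=\frac1N\sum_{j=1}^N\Phi_j$. Let $\gamma>0$, $\alpha>0$ and $q_0,p_0\in X$. On a probability space $(\Omega,\mathcal{F},\mathbb{P})$ let $(i(t))_{t\ge0}$ be the index process: a continuous-time Markov process on $I$ with (almost surely) càdlàg paths, transition rate matrix $\mathbf{\Gamma}_N-N\gamma\,\mathbf{I}_N$, where $\mathbf{I}_N$ is the identity matrix and all entries of the $N\times N$ matrix $\mathbf{\Gamma}_N$ are equal to $\gamma$, and with $i(0)$ uniformly distributed on $I$. For $\nu>0$ let $(q^\nu_t,p^\nu_t)_{t\ge0}$ be the homogeneous stochastic gradient-momentum process with unit mass and viscosity friction $\alpha$, that is, a random continuous path in $X^2$ which almost surely solves (in integrated form) $$\mathrm{d}q^\nu_t=p^\nu_t\,\mathrm{d}t,\qquad \mathrm{d}p^\nu_t=-\nabla\Phi_{i(t/\nu)}(q^\nu_t)\,\mathrm{d}t-\alpha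 p^\nu_t\,\mathrm{d}t,\qquad q^\nu_0=q_0,\quad p^\nu_0=p_0,$$ and let $(q_t,p_t)_{t\ge0}$ be the solution of the underdamped gradient flow $$\frac{\mathrm{d}q_t}{\mathrm{d}t}=p_t,\qquad \frac{\mathrm{d}p_t}{\mathrm{d}t}=-\nabla\bar\Phi(q_t)-\alpha p_t,$$ with the same initial values $(q_0,p_0)$ at $t=0$. Equip the space $\mathcal{C}([0,\infty):X^2)$ of continuous paths with the metric $$\rho(\zeta,\xi)=\int_0^\infty e^{-t}\Big(1\wedge\sup_{0\le s\le t}\|\zeta_s-\xi_s\|\Big)\,\mathrm{d}t$$ and its Borel $\sigma$-algebra. Then, for every $\nu>0$, $(q^\nu_t,p^\nu_t)_{t\ge0}$ is a random variable in $\mathcal{C}([0,\infty):X^2)$ (measurable up to modification on a null set), and as $\nu\to0$ it converges weakly in $\mathcal{C}([0,\infty):X^2)$ to the deterministic path $(q_t,p_t)_{t\ge0}$: for every bounded continuous $F:\mathcal{C}([0,\infty):X^2)\to\mathbb{R}$, $$\mathbb{E}\big[F\big((q^\nu_t,p^\nu_t)_{t\ge0}\big)\big]\longrightarrow F\big((q_t,p_t)_{t\ge0}\big)\qquad(\nu\downarrow0).$$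 -/

import Mathlib

open MeasureTheory ProbabilityTheory Filter Topology
open scoped NNReal BoundedContinuousFunction Gradient

/-! ### The space of continuous paths `C([0,∞) : X²)` -/

/-- `X = ℝ^K` with the Euclidean norm. -/
abbrev XSpace (K : ℕ) : Type := EuclideanSpace ℝ (Fin K)

/-- `X²` with the Euclidean norm `‖(q, p)‖² = ‖q‖² + ‖p‖²`. -/
abbrev PhaseSpace (K : ℕ) : Type := WithLp 2 (XSpace K × XSpace K)

/-- The set `C([0,∞) : X²)` of continuous paths `t ↦ (q_t, p_t)`. This is a type synonym of
`C(ℝ≥0, X²)`: its topology is the one induced by the metric `pathDist` below. -/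
def PathSpace (K : ℕ) : Type := C(ℝ≥0, PhaseSpace K)

namespace PathSpace

variable {K : ℕ}

instance : FunLike (PathSpace K) ℝ≥0 (PhaseSpace K) :=
  inferInstanceAs (FunLike C(ℝ≥0, PhaseSpace K) ℝ≥0 (PhaseSpace K))

instance : ContinuousMapClass (PathSpace K) ℝ≥0 (PhaseSpace K) :=
  inferInstanceAs (ContinuousMapClass C(ℝ≥0, PhaseSpace K) ℝ≥0 (PhaseSpace K))

/-- The position component `q_t` of the path `z = (q, p)`. -/
def pos (z : PathSpace K) (t : ℝ≥0) : XSpace K := (z t).fst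

/-- The velocity component `p_t` of the path `z = (q, p)`. -/
def vel (z : PathSpace K) (t : ℝ≥0) : XSpace K := (z t).snd

/-- `sup_{0 ≤ s ≤ t} ‖ζ_s - ξ_s‖`. -/
noncomputable def supDist (ζ ξ : PathSpace K) (t : ℝ≥0) : ℝ :=
  ⨆ s : Set.Icc (0 : ℝ≥0) t, ‖ζ s - ξ s‖

/-- `ρ(ζ, ξ) = ∫₀^∞ e^{-t} (1 ∧ sup_{0 ≤ s ≤ t} ‖ζ_s - ξ_s‖) dt`. -/
noncomputable def pathDist (ζ ξ : PathSpace K) : ℝ :=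
  ∫ t in Set.Ioi (0 : ℝ), Real.exp (-t) * min 1 (supDist ζ ξ t.toNNReal)

lemma bddAbove_supDist (ζ ξ : PathSpace K) (t : ℝ≥0) :
    BddAbove (Set.range fun s : Set.Icc (0 : ℝ≥0) t => ‖ζ s - ξ s‖) := by
  have h : Continuous fun s : ℝ≥0 => ‖ζ s - ξ s‖ :=
    ((map_continuous ζ).sub (map_continuous ξ)).norm
  have := (isCompact_Icc (a := (0 : ℝ≥0)) (b := t)).bddAbove_image h.continuousOn
  rwa [Set.image_eq_range] at this

lemma norm_le_supDist (ζ ξ : PathSpace K) {s t : ℝ≥0} (h : s ≤ t) :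
    ‖ζ s - ξ s‖ ≤ supDist ζ ξ t :=
  le_ciSup (bddAbove_supDist ζ ξ t) ⟨s, zero_le, h⟩

lemma supDist_le (ζ ξ : PathSpace K) {t : ℝ≥0} {c : ℝ} (h : ∀ s ≤ t, ‖ζ s - ξ s‖ ≤ c) :
    supDist ζ ξ t ≤ c := by
  have : Nonempty (Set.Icc (0 : ℝ≥0) t) := ⟨⟨0, le_rfl, zero_le⟩⟩
  exact ciSup_le fun s => h s s.2.2

lemma supDist_nonneg (ζ ξ : PathSpace K) (t : ℝ≥0) : 0 ≤ supDist ζ ξ t :=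
  (norm_nonneg _).trans (norm_le_supDist ζ ξ (zero_le (a := t)))

lemma supDist_mono (ζ ξ : PathSpace K) : Monotone (supDist ζ ξ) := fun _ _ h =>
  supDist_le ζ ξ fun _ hs => norm_le_supDist ζ ξ (hs.trans h)

lemma supDist_comm (ζ ξ : PathSpace K) (t : ℝ≥0) : supDist ζ ξ t = supDist ξ ζ t := by
  simp only [supDist, norm_sub_rev]

lemma supDist_triangle (ζ ξ η : PathSpace K) (t : ℝ≥0) :
    supDist ζ η t ≤ supDist ζ ξ t + supDist ξ η t :=
  supDist_le ζ η fun s hs => (norm_sub_le_norm_sub_add_norm_sub (ζ s) (ξ s) (η s)).trans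
    (add_le_add (norm_le_supDist ζ ξ hs) (norm_le_supDist ξ η hs))

lemma integrableOn_pathDist (ζ ξ : PathSpace K) :
    IntegrableOn (fun t : ℝ => Real.exp (-t) * min 1 (supDist ζ ξ t.toNNReal))
      (Set.Ioi 0) := by
  have hm : Measurable fun t : ℝ => min 1 (supDist ζ ξ t.toNNReal) :=
    measurable_const.min ((supDist_mono ζ ξ).comp fun _ _ h => Real.toNNReal_mono h).measurable
  refine Integrable.mono' (integrableOn_exp_neg_Ioi 0) (by fun_prop) (ae_of_all _ fun t => ?_)
  have h0 : 0 ≤ min 1 (supDist ζ ξ t.toNNReal) := le_min zero_le_one (supDist_nonneg ζ ξ _)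
  rw [Real.norm_of_nonneg (mul_nonneg (Real.exp_pos _).le h0)]
  exact mul_le_of_le_one_right (Real.exp_pos _).le (min_le_left _ _)

lemma pathDist_self (ζ : PathSpace K) : pathDist ζ ζ = 0 := by
  have h : ∀ t, supDist ζ ζ t = 0 := fun t =>
    le_antisymm (supDist_le ζ ζ fun s _ => by simp) (supDist_nonneg ζ ζ t)
  simp [pathDist, h]

lemma pathDist_comm (ζ ξ : PathSpace K) : pathDist ζ ξ = pathDist ξ ζ := by
  simp only [pathDist, supDist_comm ζ ξ]

lemma pathDist_triangle (ζ ξ η : PathSpace K) :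
    pathDist ζ η ≤ pathDist ζ ξ + pathDist ξ η := by
  unfold pathDist
  rw [← integral_add (integrableOn_pathDist ζ ξ) (integrableOn_pathDist ξ η)]
  refine integral_mono (integrableOn_pathDist ζ η)
    ((integrableOn_pathDist ζ ξ).add (integrableOn_pathDist ξ η)) fun t => ?_
  simp only [← mul_add]
  refine mul_le_mul_of_nonneg_left ?_ (Real.exp_pos _).le
  have h1 := supDist_triangle ζ ξ η t.toNNReal
  have h2 := supDist_nonneg ζ ξ t.toNNReal
  have h3 := supDist_nonneg ξ η t.toNNReal
  rcases min_cases 1 (supDist ζ ξ t.toNNReal) with h | h <;>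
  rcases min_cases 1 (supDist ξ η t.toNNReal) with h' | h' <;>
  rcases min_cases 1 (supDist ζ η t.toNNReal) with h'' | h'' <;> linarith

lemma eq_of_pathDist_eq_zero (ζ ξ : PathSpace K) (h : pathDist ζ ξ = 0) : ζ = ξ := by
  have hnn : ∀ t : ℝ, 0 ≤ Real.exp (-t) * min 1 (supDist ζ ξ t.toNNReal) := fun t =>
    mul_nonneg (Real.exp_pos _).le (le_min zero_le_one (supDist_nonneg ζ ξ _))
  have hae := (integral_eq_zero_iff_of_nonneg hnn (integrableOn_pathDist ζ ξ)).1 h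
  refine DFunLike.ext ζ ξ fun s => ?_
  have hpos : volume (Set.Ioi (s : ℝ)) ≠ 0 := by simp
  have hsub : Set.Ioi (s : ℝ) ⊆ Set.Ioi 0 := Set.Ioi_subset_Ioi s.2
  have hae' := ae_restrict_of_ae_restrict_of_subset hsub hae
  have : (ae (volume.restrict (Set.Ioi (s : ℝ)))).NeBot := by
    rw [ae_neBot]; simp
  obtain ⟨t, ht, hts⟩ := (hae'.and (ae_restrict_mem measurableSet_Ioi)).exists
  have h1 : min 1 (supDist ζ ξ t.toNNReal) = 0 := by
    simpa [(Real.exp_pos _).ne'] using ht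
  have h2 : ‖ζ s - ξ s‖ ≤ supDist ζ ξ t.toNNReal :=
    norm_le_supDist ζ ξ (NNReal.le_toNNReal_of_coe_le (le_of_lt hts))
  have h3 : supDist ζ ξ t.toNNReal = 0 := by
    rcases min_cases 1 (supDist ζ ξ t.toNNReal) with h | h <;> linarith
  exact sub_eq_zero.1 (norm_eq_zero.1 (le_antisymm (h2.trans h3.le) (norm_nonneg _)))

/-- `C([0,∞) : X²)` is equipped with the metric `ρ`. -/
noncomputable instance : MetricSpace (PathSpace K) where
  dist := pathDist
  dist_self := pathDist_self
  dist_comm := pathDist_comm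
  dist_triangle := pathDist_triangle
  eq_of_dist_eq_zero := eq_of_pathDist_eq_zero _ _

noncomputable instance : MeasurableSpace (PathSpace K) := borel _

instance : BorelSpace (PathSpace K) := ⟨rfl⟩

end PathSpace

/-! ### The index process -/

/-- The transition rate matrix `A_N = Γ_N - N γ I_N`, all entries of `Γ_N` being `γ`. -/
def rateMatrix (N : ℕ) (γ : ℝ) : Matrix (Fin N) (Fin N) ℝ :=
  Matrix.of (fun _ _ => γ) - (N * γ) • (1 : Matrix (Fin N) (Fin N) ℝ)

/-- The σ-algebra generated by `(i(s))_{s ≤ t}`. -/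
abbrev pastSigma {Ω : Type*} {N : ℕ} (i : ℝ≥0 → Ω → Fin N) (t : ℝ≥0) : MeasurableSpace Ω :=
  ⨆ s ∈ Set.Iic t, MeasurableSpace.comap (i s) ⊤

/-- `i` is a continuous-time (càdlàg, time-homogeneous) Markov process on `{1, …, N}` with
transition rate matrix `rateMatrix N γ` and uniform initial distribution. -/
structure IsIndexProcess {Ω : Type*} [MeasurableSpace Ω] (P : Measure Ω) {N : ℕ} (γ : ℝ)
    (i : ℝ≥0 → Ω → Fin N) : Prop where
  measurable : ∀ t, Measurable (i t)
  cadlag : ∀ᵐ ω ∂P, ∀ t : ℝ≥0,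
    ContinuousWithinAt (fun s => i s ω) (Set.Ici t) t ∧
      ∃ j, Tendsto (fun s => i s ω) (𝓝[<] t) (𝓝 j)
  uniform_init : ∀ j, P.real (i 0 ⁻¹' {j}) = 1 / N
  markov : ∀ (t s : ℝ≥0) (j : Fin N),
    P⟦i (t + s) ⁻¹' {j} | pastSigma i t⟧ =ᵐ[P]
      fun ω => NormedSpace.exp ((s : ℝ) • rateMatrix N γ) (i t ω) j

/-! ### The dynamical systems -/

/-- The full potential `Φ̄ = (1/N) ∑ᵢ Φᵢ`. -/
noncomputable def fullPotential {K N : ℕ} (Φ : Fin N → XSpace K → ℝ) (x : XSpace K) : ℝ :=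
  (1 / N : ℝ) * ∑ j, Φ j x

/-- The path `z = (q, p)` solves, for the (piecewise constant) index path `j`,
`dq_t = p_t dt`, `m dp_t = - ∇Φ_{j(t)}(q_t) dt - α p_t dt`, `q(0) = q₀`, `p(0) = p₀`.
As `j` jumps, the system is understood in integrated form. -/
structure IsMomentumPath {K N : ℕ} (Φ : Fin N → XSpace K → ℝ) (α m : ℝ) (q₀ p₀ : XSpace K)
    (j : ℝ≥0 → Fin N) (z : PathSpace K) : Prop where
  pos_eq : ∀ t : ℝ≥0, z.pos t = q₀ + ∫ s in (0 : ℝ)..t, z.vel s.toNNReal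
  integrable : ∀ t : ℝ≥0, IntervalIntegrable
    (fun s : ℝ => -∇ (Φ (j s.toNNReal)) (z.pos s.toNNReal) - α • z.vel s.toNNReal) volume 0 t
  vel_eq : ∀ t : ℝ≥0, m • z.vel t = m • p₀ +
    ∫ s in (0 : ℝ)..t, (-∇ (Φ (j s.toNNReal)) (z.pos s.toNNReal) - α • z.vel s.toNNReal)

/-- The random path `Z = (q^{ν,m}, p^{ν,m})` is a homogeneous stochastic gradient-momentum
process with learning rate parameter `ν`, mass `m`, viscosity friction `α`, driven by
`i^ν(t) = i(t/ν)`. -/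
def IsHSGMP {Ω : Type*} [MeasurableSpace Ω] (P : Measure Ω) {K N : ℕ}
    (Φ : Fin N → XSpace K → ℝ) (α m : ℝ) (q₀ p₀ : XSpace K) (i : ℝ≥0 → Ω → Fin N) (ν : ℝ≥0)
    (Z : Ω → PathSpace K) : Prop :=
  ∀ᵐ ω ∂P, IsMomentumPath Φ α m q₀ p₀ (fun t => i (t / ν) ω) (Z ω)

/-- The path `z = (q, p)` solves the underdamped gradient flow
`dq_t/dt = p_t`, `dp_t/dt = - ∇Ψ(q_t) - α p_t` on `[0,∞)` with `q(0) = q₀`, `p(0) = p₀`. -/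
structure IsUnderdampedGradientFlow {K : ℕ} (Ψ : XSpace K → ℝ) (α : ℝ) (q₀ p₀ : XSpace K)
    (z : PathSpace K) : Prop where
  pos_zero : z.pos 0 = q₀
  vel_zero : z.vel 0 = p₀
  deriv_pos : ∀ t : ℝ≥0,
    HasDerivWithinAt (fun s : ℝ => z.pos s.toNNReal) (z.vel t) (Set.Ici 0) t
  deriv_vel : ∀ t : ℝ≥0,
    HasDerivWithinAt (fun s : ℝ => z.vel s.toNNReal) (-∇ Ψ (z.pos t) - α • z.vel t)
      (Set.Ici 0) t

/-! ### The path space -/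

namespace PathSpace

variable {K : ℕ}

/-! In phase space both dynamics are first-order equations with globally Lipschitz right-hand sides:
the random one switches between the fields $V_j(q,p)=(p,-\nabla\Phi_j(q)-\alpha p)$, and the limit
follows their average (`average_momentumField`). Let $J(s)=i(s/\nu)$, let $y$ be the random path and
$z$ the limit. Since $V_k-\frac1N\sum_jV_j=\sum_jc_j(k)V_j$ with $c_j(k)=1_{k=j}-1/N$,
$$y_t-z_t=M_t+\int_0^t\big(V_{J(s)}(y_s)-V_{J(s)}(z_s)\big)\,ds,\qquad
M_t=\sum_j\int_0^tc_j(J(s))\,V_j(z_s)\,ds.$$ By Gronwall, $\|y-z\|$ on $[0,T]$ is at most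
$e^{CT}\sup_{[0,T]}\|M\|$ (`norm_sub_le_of_averaging_error`). The error is measured along the
deterministic path $z$, so in $M$ only the factors $c_j(J(s))$ are random.

Each $c_j$ is an eigenfunction of the transition semigroup, with eigenvalue $e^{-N\gamma s}$. The
covariance of $c_j(J(s))$ and $c_j(J(r))$ is therefore at most $e^{-N\gamma|s-r|/\nu}$, which
vanishes off the diagonal as $\nu\to0$. Writing the squared norm of the integral as a double
integral, dominated convergence gives $M_t\to0$ in mean square for each $t$. Paths of $M$ are
Lipschitz on $[0,T]$ uniformly in $\nu$ and $\omega$, so a finite grid makes this uniform in $t$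
(`tendsto_measureReal_averaging_error`). Hence $\rho(y,z)\to0$ in probability, and the limit being
deterministic, weak convergence follows without any tightness argument.

Measurability is a separate matter: almost surely the path is the limit of Picard iterates, which
are measurable in $\omega$, and evaluations generate enough of the Borel structure of the path space
(`PathSpace.measurable_of_eval`). -/

lemma pathDist_le_supDist_add_exp (ζ ξ : PathSpace K) (T : ℝ≥0) :
    pathDist ζ ξ ≤ supDist ζ ξ T + Real.exp (-T) := by
  have hT : Set.Ioi (T : ℝ) ⊆ Set.Ioi 0 := Set.Ioi_subset_Ioi T.2
  have hi1 : IntegrableOn (fun t : ℝ => Real.exp (-t) * supDist ζ ξ T) (Set.Ioi 0) :=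
    (integrableOn_exp_neg_Ioi 0).mul_const _
  have hi2 : IntegrableOn ((Set.Ioi (T : ℝ)).indicator fun t : ℝ => Real.exp (-t))
      (Set.Ioi 0) := (integrableOn_exp_neg_Ioi 0).indicator measurableSet_Ioi
  -- Up to $T$ the running supremum is at most its value at $T$; beyond $T$ the truncation at 1
  -- leaves the tail $\int_T^\infty e^{-t}\,dt$.
  have h : pathDist ζ ξ ≤ ∫ t in Set.Ioi (0 : ℝ), (Real.exp (-t) * supDist ζ ξ T +
      (Set.Ioi (T : ℝ)).indicator (fun t : ℝ => Real.exp (-t)) t) := by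
    refine integral_mono (integrableOn_pathDist ζ ξ) (hi1.add hi2) fun t => ?_
    have h0 := supDist_nonneg ζ ξ T
    have he := (Real.exp_pos (-t)).le
    by_cases ht : (T : ℝ) < t
    · simp only [Set.indicator_of_mem (show t ∈ Set.Ioi (T : ℝ) from ht)]
      have := mul_le_of_le_one_right he (min_le_left 1 (supDist ζ ξ t.toNNReal))
      nlinarith [mul_nonneg he h0]
    · simp only [Set.indicator_of_notMem (show t ∉ Set.Ioi (T : ℝ) from ht), add_zero]
      refine mul_le_mul_of_nonneg_left ((min_le_right _ _).trans (supDist_mono ζ ξ ?_)) he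
      exact Real.toNNReal_le_iff_le_coe.2 (not_lt.1 ht)
  refine h.trans (le_of_eq ?_)
  rw [integral_add hi1 hi2, integral_mul_const, integral_exp_neg_Ioi_zero, one_mul,
    setIntegral_indicator measurableSet_Ioi, Set.inter_eq_right.2 hT, integral_exp_neg_Ioi]

/-- The metric sees times beyond $T$ only through $e^{-T}$. Making that less than $\delta/3$ gives a
total below $2\delta/3$. -/
lemma exists_forall_le_dist_lt (x : PathSpace K) {δ : ℝ} (hδ : 0 < δ) :
    ∃ T : ℝ≥0, ∀ y : PathSpace K, (∀ s ≤ T, ‖y s - x s‖ ≤ δ / 3) → dist y x < δ := by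
  obtain ⟨T, hT⟩ : ∃ T : ℝ≥0, Real.exp (-T) < δ / 3 := by
    have h : Tendsto (fun T : ℝ≥0 => Real.exp (-T)) atTop (𝓝 0) :=
      Real.tendsto_exp_neg_atTop_nhds_zero.comp (NNReal.tendsto_coe_atTop.2 tendsto_id)
    exact (h.eventually (gt_mem_nhds (by positivity))).exists
  refine ⟨T, fun y hy => ?_⟩
  have h1 := pathDist_le_supDist_add_exp y x T
  have h2 := supDist_le y x hy
  change pathDist y x < δ
  linarith

/-- A random path is measurable as soon as all its evaluations are. -/
lemma measurable_of_eval {Ω : Type*} [MeasurableSpace Ω] {Z : Ω → PathSpace K}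
    (h : ∀ t, StronglyMeasurable fun ω => Z ω t) : Measurable Z := by
  refine measurable_of_isOpen fun U hU => ?_
  have hB : ∀ x : PathSpace K, x ∈ U → ∃ T : ℝ≥0, ∃ ε : ℝ, 0 < ε ∧
      {y : PathSpace K | ∀ s ≤ T, ‖y s - x s‖ ≤ ε} ⊆ U := by
    intro x hx
    obtain ⟨δ, hδ, hball⟩ := Metric.isOpen_iff.1 hU x hx
    obtain ⟨T, hT⟩ := exists_forall_le_dist_lt x hδ
    exact ⟨T, δ / 3, by positivity, fun y hy => hball (hT y hy)⟩
  choose! T ε hε hsub using hB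
  let B : PathSpace K → Set (PathSpace K) := fun x => {y | ∀ s ≤ T x, ‖y s - x s‖ ≤ ε x}
  -- Each `B x` is a neighbourhood of `x` in the compact-open topology, whose second countability
  -- allows `U` to be covered by countably many of them.
  have hnhds : ∀ x ∈ U, @nhds C(ℝ≥0, PhaseSpace K) _ x ⊓ 𝓟 U ≤ 𝓟 (B x) := by
    intro x hx
    refine inf_le_left.trans (le_principal_iff.2 ?_)
    have h1 := (ContinuousMap.tendsto_iff_forall_isCompact_tendstoUniformlyOn
      (F := fun f : C(ℝ≥0, PhaseSpace K) => f) (f := x)).1 tendsto_id (Set.Icc 0 (T x))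
      isCompact_Icc
    filter_upwards [Metric.tendstoUniformlyOn_iff.1 h1 (ε x) (hε x hx)] with y hy s hs
    have := hy s ⟨zero_le, hs⟩
    rw [dist_comm, dist_eq_norm] at this
    exact this.le
  obtain ⟨t, htU, htc, hcov⟩ := @TopologicalSpace.countable_cover_nhdsWithin
    C(ℝ≥0, PhaseSpace K) _ _ B U fun x hx => le_principal_iff.1 (hnhds x hx)
  have hUeq : Z ⁻¹' U = ⋃ x ∈ t, Z ⁻¹' B x := by
    ext ω
    simp only [Set.mem_preimage, Set.mem_iUnion]
    constructor
    · intro hω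
      obtain ⟨x, hx, h⟩ := Set.mem_iUnion₂.1 (hcov hω)
      exact ⟨x, hx, h⟩
    · rintro ⟨x, hx, hω⟩
      exact hsub x (htU hx) hω
  rw [hUeq]
  refine MeasurableSet.biUnion htc fun x _ => ?_
  obtain ⟨D, hDc, hDd⟩ := TopologicalSpace.exists_countable_dense ℝ≥0
  -- Clamping times at `T x` lets a dense set of the whole half-line test the condition on $[0,T]$.
  have hBeq : Z ⁻¹' B x = ⋂ s ∈ D, {ω | ‖Z ω (min s (T x)) - x (min s (T x))‖ ≤ ε x} := by
    ext ω
    simp only [Set.mem_preimage, Set.mem_iInter, Set.mem_ofPred_eq, B]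
    constructor
    · exact fun hω s _ => hω _ (min_le_right _ _)
    · intro hω s hs
      have hcl : IsClosed {s : ℝ≥0 | ‖Z ω (min s (T x)) - x (min s (T x))‖ ≤ ε x} := by
        refine isClosed_le ?_ continuous_const
        have hmin : Continuous fun s : ℝ≥0 => min s (T x) := by fun_prop
        exact (((map_continuous (Z ω)).comp hmin).sub ((map_continuous x).comp hmin)).norm
      have := hcl.closure_subset_iff.2 (show D ⊆ _ from hω) (hDd s)
      rw [Set.mem_ofPred_eq, min_eq_left hs] at this
      exact this
  rw [hBeq]
  exact MeasurableSet.biInter hDc fun s _ =>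
    measurableSet_le ((h _).sub stronglyMeasurable_const).norm.measurable measurable_const

end PathSpace

/-! ### Gronwall's inequality in integral form and Picard iteration -/

/-- Gronwall's inequality in integral form. -/
lemma le_mul_exp_of_le_add_mul_integral {e : ℝ → ℝ} (he : Continuous e) (he0 : ∀ t, 0 ≤ e t)
    {M C T : ℝ} (hC : 0 ≤ C)
    (h : ∀ t ∈ Set.Icc 0 T, e t ≤ M + C * ∫ s in (0 : ℝ)..t, e s) :
    ∀ t ∈ Set.Icc 0 T, e t ≤ M * Real.exp (C * t) := by
  have hd : ∀ t, HasDerivAt (fun t => ∫ s in (0 : ℝ)..t, e s) (e t) t := fun t =>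
    intervalIntegral.integral_hasDerivAt_right (he.intervalIntegrable _ _)
      he.stronglyMeasurable.stronglyMeasurableAtFilter he.continuousAt
  -- The differential form is applied to the primitive of $e$, which starts at 0; its bound is then
  -- inserted back into the hypothesis.
  have hg := norm_le_gronwallBound_of_norm_deriv_right_le (a := 0) (b := T) (δ := 0) (K := C)
    (ε := M) (f := fun t => ∫ s in (0 : ℝ)..t, e s) (f' := e)
    (fun t _ => (hd t).continuousAt.continuousWithinAt) (fun t _ => (hd t).hasDerivWithinAt)
    (by simp) (fun t ht => by
      rw [Real.norm_of_nonneg (he0 t), Real.norm_of_nonneg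
        (intervalIntegral.integral_nonneg ht.1 fun s _ => he0 s)]
      linarith [h t (Set.Ico_subset_Icc_self ht)])
  intro t ht
  have h1 := h t ht
  have h2 := (le_abs_self _).trans (hg t ht)
  rcases hC.eq_or_lt with rfl | hC'
  · simpa using h1
  · rw [gronwallBound_of_K_ne_0 hC'.ne'] at h2
    have h3 : C * ∫ s in (0 : ℝ)..t, e s ≤ M * (Real.exp (C * t) - 1) := by
      calc _ ≤ C * (0 * Real.exp (C * (t - 0)) + M / C * (Real.exp (C * (t - 0)) - 1)) :=
            mul_le_mul_of_nonneg_left h2 hC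
        _ = _ := by field_simp; simp
    linarith

section Picard

variable {E : Type*} [NormedAddCommGroup E] {N : ℕ}

lemma stronglyMeasurable_switching {β : Type*} [MeasurableSpace β] {V : Fin N → E → E}
    (hV : ∀ j, Continuous (V j)) {J : β → Fin N} (hJ : Measurable J) {Y : β → E}
    (hY : StronglyMeasurable Y) : StronglyMeasurable fun b => V (J b) (Y b) := by
  have hc : Continuous fun p : Fin N × E => V p.1 p.2 :=
    continuous_prod_of_discrete_left.2 hV
  exact hc.comp_stronglyMeasurable (hJ.stronglyMeasurable.prodMk hY)

lemma intervalIntegrable_switching {V : Fin N → E → E} (hV : ∀ j, Continuous (V j))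
    {J : ℝ → Fin N} (hJ : Measurable J) {y : ℝ → E} (hy : Continuous y) (a b : ℝ) :
    IntervalIntegrable (fun s => V (J s) (y s)) volume a b := by
  -- The sum over all states dominates the integrand whatever the index does, and it is continuous.
  have hc : Continuous fun s => ∑ j, ‖V j (y s)‖ :=
    continuous_finsetSum _ fun j _ => ((hV j).comp hy).norm
  refine (hc.intervalIntegrable a b).mono_fun
    (stronglyMeasurable_switching hV hJ hy.stronglyMeasurable).aestronglyMeasurable
    (ae_of_all _ fun s => ?_)
  refine (Finset.single_le_sum (f := fun j => ‖V j (y s)‖) (fun j _ => norm_nonneg _)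
    (Finset.mem_univ (J s))).trans (le_abs_self _)

variable [NormedSpace ℝ E]

/-- The Picard iterates of the switched equation `dY = V_{J(t)}(Y) dt`, `Y(0) = x`. -/
noncomputable def picardIterate {Ω : Type*} (V : Fin N → E → E) (x : E) (J : ℝ → Ω → Fin N) :
    ℕ → ℝ → Ω → E
  | 0 => fun _ _ => x
  | n + 1 => fun t ω => x + ∫ s in (0 : ℝ)..t, V (J s ω) (picardIterate V x J n s ω)

lemma continuous_picardIterate {Ω : Type*} [MeasurableSpace Ω] {V : Fin N → E → E}
    (hV : ∀ j, Continuous (V j)) (x : E) {J : ℝ → Ω → Fin N}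
    (hJ : Measurable (Function.uncurry J)) (n : ℕ) (ω : Ω) :
    Continuous fun t => picardIterate V x J n t ω := by
  induction n with
  | zero => exact continuous_const
  | succ n ih =>
    exact continuous_const.add (intervalIntegral.continuous_primitive (fun a b =>
      intervalIntegrable_switching hV (hJ.comp (measurable_id.prodMk measurable_const)) ih a b) 0)

lemma stronglyMeasurable_picardIterate {Ω : Type*} [MeasurableSpace Ω] {V : Fin N → E → E}
    (hV : ∀ j, Continuous (V j)) (x : E) {J : ℝ → Ω → Fin N}
    (hJ : Measurable (Function.uncurry J)) (n : ℕ) (t : ℝ) :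
    StronglyMeasurable fun ω => picardIterate V x J n t ω := by
  induction n generalizing t with
  | zero => exact stronglyMeasurable_const
  | succ n ih =>
    have h1 : StronglyMeasurable (Function.uncurry fun s ω => picardIterate V x J n s ω) :=
      stronglyMeasurable_uncurry_of_continuous_of_stronglyMeasurable
        (continuous_picardIterate hV x hJ n) ih
    have h2 : StronglyMeasurable fun p : Ω × ℝ => V (J p.2 p.1) (picardIterate V x J n p.2 p.1) :=
      (stronglyMeasurable_switching hV hJ h1).comp_measurable measurable_swap
    refine stronglyMeasurable_const.add ?_
    simp only [intervalIntegral]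
    exact h2.integral_prod_right.sub h2.integral_prod_right

/-- Every solution is the limit of the same iterates, by the factorial estimate of Picard–Lindelöf.
This transfers measurability in $\omega$ to a solution not assumed measurable. -/
lemma tendsto_picardIterate {Ω : Type*} [MeasurableSpace Ω] {V : Fin N → E → E} {C : ℝ≥0}
    (hV : ∀ j, LipschitzWith C (V j)) (x : E) {J : ℝ → Ω → Fin N}
    (hJ : Measurable (Function.uncurry J)) {ω : Ω} {y : ℝ → E} (hy : Continuous y)
    (hsol : ∀ t, 0 ≤ t → y t = x + ∫ s in (0 : ℝ)..t, V (J s ω) (y s)) {T : ℝ} (hT : 0 ≤ T) :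
    Tendsto (fun n => picardIterate V x J n T ω) atTop (𝓝 (y T)) := by
  have hVc : ∀ j, Continuous (V j) := fun j => (hV j).continuous
  have hJω : Measurable fun s => J s ω := hJ.comp (measurable_id.prodMk measurable_const)
  obtain ⟨B, hB⟩ := (isCompact_Icc (a := 0) (b := T)).exists_bound_of_continuousOn
    (continuous_const.sub hy).continuousOn (f := fun s => x - y s)
  have key : ∀ n : ℕ, ∀ t ∈ Set.Icc 0 T,
      ‖picardIterate V x J n t ω - y t‖ ≤ B * ((C * t) ^ n / n.factorial) := by
    intro n
    induction n with
    | zero => intro t ht; simpa [picardIterate] using hB t ht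
    | succ n ih =>
      intro t ht
      have hcont := continuous_picardIterate hVc x hJ n ω
      have h1 : picardIterate V x J (n + 1) t ω - y t =
          ∫ s in (0 : ℝ)..t, (V (J s ω) (picardIterate V x J n s ω) - V (J s ω) (y s)) := by
        rw [intervalIntegral.integral_sub (intervalIntegrable_switching hVc hJω hcont 0 t)
          (intervalIntegrable_switching hVc hJω hy 0 t), hsol t ht.1]
        simp [picardIterate]
      rw [h1]
      have h2 : ∫ s in (0 : ℝ)..t, (C : ℝ) * (B * ((C * s) ^ n / n.factorial)) =
          B * ((C * t) ^ (n + 1) / (n + 1).factorial) := by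
        have : (fun s : ℝ => (C : ℝ) * (B * ((C * s) ^ n / n.factorial))) =
            fun s => (C ^ (n + 1) * B / n.factorial) * s ^ n := by
          ext s; rw [mul_pow]; ring
        rw [this, intervalIntegral.integral_const_mul, integral_pow, Nat.factorial_succ]
        push_cast
        rw [mul_pow]
        field_simp
        simp
      rw [← h2]
      refine intervalIntegral.norm_integral_le_of_norm_le ht.1 (ae_of_all _ fun s hs => ?_)
        (Continuous.intervalIntegrable (by fun_prop) _ _)
      rw [← dist_eq_norm]
      refine ((hV _).dist_le_mul _ _).trans (mul_le_mul_of_nonneg_left ?_ C.2)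
      rw [dist_eq_norm]
      exact ih s ⟨hs.1.le, hs.2.trans ht.2⟩
  rw [tendsto_iff_norm_sub_tendsto_zero]
  refine squeeze_zero (fun n => norm_nonneg _) (fun n => key n T ⟨hT, le_rfl⟩) ?_
  simpa using (FloorSemiring.tendsto_pow_div_factorial_atTop (C * T)).const_mul B

end Picard

/-! ### The index process -/

lemma measurable_uncurry_of_rightContinuous {Ω β : Type*} [MeasurableSpace Ω]
    [TopologicalSpace β] [TopologicalSpace.PseudoMetrizableSpace β] [MeasurableSpace β]
    [BorelSpace β] {u : ℝ≥0 → Ω → β}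
    (hu : ∀ t, Measurable (u t))
    (hc : ∀ ω t, ContinuousWithinAt (fun s => u s ω) (Set.Ici t) t) :
    Measurable (Function.uncurry u) := by
  -- The first point of the grid of mesh $1/(n+1)$ strictly after $t$: it takes countably many
  -- values and approaches $t$ from the right.
  let a : ℕ → ℝ≥0 → ℝ≥0 := fun n t => ((⌊((n : ℝ≥0) + 1) * t⌋₊ : ℝ≥0) + 1) / (n + 1)
  have ha_ge : ∀ n t, t ≤ a n t := by
    intro n t
    rw [le_div_iff₀ (by positivity), mul_comm]
    exact (Nat.lt_floor_add_one _).le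
  have ha_le : ∀ n t, a n t ≤ t + 1 / ((n : ℝ≥0) + 1) := by
    intro n t
    have hn : (n : ℝ≥0) + 1 ≠ 0 := by positivity
    rw [div_le_iff₀ (by positivity), add_mul t, one_div, inv_mul_cancel₀ hn, mul_comm t]
    gcongr
    exact Nat.floor_le zero_le
  have ha : ∀ t, Tendsto (fun n => a n t) atTop (𝓝[≥] t) := by
    intro t
    refine tendsto_nhdsWithin_iff.2 ⟨?_, Eventually.of_forall fun n => ha_ge n t⟩
    refine tendsto_of_tendsto_of_tendsto_of_le_of_le tendsto_const_nhds ?_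
      (fun n => ha_ge n t) (fun n => ha_le n t)
    simpa using (tendsto_const_nhds (x := t)).add
      (tendsto_one_div_add_atTop_nhds_zero_nat (𝕜 := ℝ≥0))
  have hmeas : ∀ n, Measurable fun p : ℝ≥0 × Ω => u (a n p.1) p.2 := by
    intro n
    have h1 : Measurable fun p : ℕ × Ω => u (((p.1 : ℝ≥0) + 1) / (n + 1)) p.2 :=
      measurable_from_prod_countable_right fun k => hu (((k : ℝ≥0) + 1) / (n + 1))
    have h2 : Measurable fun p : ℝ≥0 × Ω => (⌊((n : ℝ≥0) + 1) * p.1⌋₊, p.2) :=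
      (Nat.measurable_floor.comp (measurable_fst.const_mul _)).prodMk measurable_snd
    simpa only [Function.comp_def] using h1.comp h2
  clear_value a
  refine measurable_of_tendsto_metrizable hmeas (tendsto_pi_nhds.2 fun p => ?_)
  exact Tendsto.comp (g := fun s => u s p.2) (hc p.2 p.1) (ha p.1)

/-- Joint measurability needs right-continuity for every $\omega$, so the paths are made constant on
a measurable null set containing the bad ones. -/
lemma IsIndexProcess.exists_rightContinuous {Ω : Type*} [MeasurableSpace Ω] {P : Measure Ω}
    {N : ℕ} [NeZero N] {γ : ℝ} {i : ℝ≥0 → Ω → Fin N} (hi : IsIndexProcess P γ i) :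
    ∃ i' : ℝ≥0 → Ω → Fin N, Measurable (Function.uncurry i') ∧ ∀ᵐ ω ∂P, ∀ t, i' t ω = i t ω := by
  classical
  obtain ⟨S, hS, hSm, hS0⟩ := exists_measurable_superset_of_null (ae_iff.1 hi.cadlag)
  refine ⟨fun t ω => if ω ∈ S then 0 else i t ω,
    measurable_uncurry_of_rightContinuous (fun t => ?_) (fun ω t => ?_), ?_⟩
  · exact Measurable.ite hSm measurable_const (hi.measurable t)
  · by_cases h : ω ∈ S
    · simpa only [h, if_true] using continuousWithinAt_const
    · simp only [h, if_false]
      by_contra hcon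
      exact h (hS fun hall => hcon (hall t).1)
  · have : ∀ᵐ ω ∂P, ω ∉ S := measure_eq_zero_iff_ae_notMem.1 hS0
    filter_upwards [this] with ω hω t
    simp [hω]

lemma exp_smul_of_isIdempotentElem {A : Type*} [Ring A] [Algebra ℝ A] [TopologicalSpace A]
    [T2Space A] [ContinuousSMul ℝ A] [IsTopologicalRing A]
    {Q : A} (hQ : IsIdempotentElem Q) (c : ℝ) :
    NormedSpace.exp (c • Q) = 1 + (Real.exp c - 1) • Q := by
  rw [NormedSpace.exp_eq_tsum ℝ]
  have h1 : HasSum (fun n : ℕ => (c ^ n / n.factorial) • Q) (Real.exp c • Q) := by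
    have := NormedSpace.expSeries_div_hasSum_exp c
    rw [← Real.exp_eq_exp_ℝ] at this
    exact this.smul_const Q
  -- Powers of $Q$ equal $Q$ except the zeroth, which is 1; the correction $1-Q$ sits at $n=0$.
  have h2 := h1.add (hasSum_ite_eq (0 : ℕ) (1 - Q))
  have h3 : (fun n : ℕ => (c ^ n / n.factorial) • Q + if n = 0 then 1 - Q else 0) =
      fun n : ℕ => ((n.factorial : ℝ)⁻¹) • (c • Q) ^ n := by
    ext n
    rcases n with _ | n
    · simp
    · rw [smul_pow, hQ.pow_succ_eq, smul_smul]
      simp [div_eq_inv_mul]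
  rw [h3] at h2
  refine h2.tsum_eq.trans ?_
  rw [sub_smul, one_smul]
  abel

/-- The centred indicator of the state `j`. -/
noncomputable def centredIndicator {N : ℕ} (j k : Fin N) : ℝ := (if k = j then 1 else 0) - 1 / N

lemma abs_centredIndicator_le_one {N : ℕ} (j k : Fin N) : |centredIndicator j k| ≤ 1 := by
  have hN : (1 : ℝ) ≤ N := by exact_mod_cast Nat.one_le_of_lt j.2
  have h1 : (1 : ℝ) / N ≤ 1 := by rw [div_le_one (by linarith)]; exact hN
  have h2 : (0 : ℝ) ≤ 1 / N := by positivity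
  unfold centredIndicator
  rw [abs_le]
  split_ifs <;> constructor <;> linarith

/-- The rate matrix is $-N\gamma$ times the projection onto vectors of zero sum, so its exponential
is explicit. -/
lemma exp_smul_rateMatrix {N : ℕ} [NeZero N] (γ s : ℝ) (k j : Fin N) :
    NormedSpace.exp (s • rateMatrix N γ) k j =
      1 / N + Real.exp (-(N * γ * s)) * centredIndicator j k := by
  have hN : (N : ℝ) ≠ 0 := NeZero.ne _
  let Q : Matrix (Fin N) (Fin N) ℝ := 1 - Matrix.of fun _ _ => (1 / N : ℝ)
  have hP : IsIdempotentElem (Matrix.of fun _ _ => (1 / N : ℝ) : Matrix (Fin N) (Fin N) ℝ) := by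
    ext a b
    simp [Matrix.mul_apply, hN]
  have hQ : IsIdempotentElem Q := hP.one_sub
  have h : s • rateMatrix N γ = (-(N * γ * s)) • Q := by
    ext a b
    simp only [rateMatrix, Q, Matrix.smul_apply, Matrix.sub_apply, Matrix.of_apply, smul_eq_mul]
    field_simp
    ring
  rw [h, exp_smul_of_isIdempotentElem hQ]
  simp only [Q, Matrix.add_apply, Matrix.smul_apply, Matrix.sub_apply, Matrix.of_apply,
    smul_eq_mul, Matrix.one_apply, centredIndicator]
  ring

/-- Conditioning on the past up to $t$ replaces the later factor by $e^{-N\gamma s}$ times the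
earlier one. -/
lemma IsIndexProcess.integral_centredIndicator_mul {Ω : Type*} [MeasurableSpace Ω]
    {P : Measure Ω} [IsProbabilityMeasure P] {N : ℕ} [NeZero N] {γ : ℝ} {i : ℝ≥0 → Ω → Fin N}
    (hi : IsIndexProcess P γ i) (t s : ℝ≥0) (j : Fin N) :
    ∫ ω, centredIndicator j (i t ω) * centredIndicator j (i (t + s) ω) ∂P =
      Real.exp (-(N * γ * s)) * ∫ ω, centredIndicator j (i t ω) ^ 2 ∂P := by
  have hm : pastSigma i t ≤ ‹MeasurableSpace Ω› :=
    iSup₂_le fun u _ => (hi.measurable u).comap_le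
  have hcm : Measurable (centredIndicator j) := measurable_from_top
  have hit : Measurable[pastSigma i t] (i t) := by
    have h : MeasurableSpace.comap (i t) ⊤ ≤ pastSigma i t :=
      le_iSup₂_of_le (f := fun s (_ : s ∈ Set.Iic t) => MeasurableSpace.comap (i s) ⊤)
        t (Set.mem_Iic.2 le_rfl) le_rfl
    exact (comap_measurable (i t)).mono h le_rfl
  have hf : StronglyMeasurable[pastSigma i t] fun ω => centredIndicator j (i t ω) :=
    (hcm.comp hit).stronglyMeasurable
  have hb : ∀ u, Integrable (fun ω => centredIndicator j (i u ω)) P := fun u =>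
    Integrable.of_bound (hcm.comp (hi.measurable u)).aestronglyMeasurable 1
      (ae_of_all _ fun ω => abs_centredIndicator_le_one _ _)
  have hind : Integrable ((i (t + s) ⁻¹' {j}).indicator fun _ => (1 : ℝ)) P :=
    (integrable_const _).indicator (hi.measurable _ (measurableSet_singleton j))
  have heq : (fun ω => centredIndicator j (i (t + s) ω)) =
      ((i (t + s) ⁻¹' {j}).indicator fun _ => (1 : ℝ)) - fun _ => (1 / N : ℝ) := by
    ext ω
    by_cases h : i (t + s) ω = j <;> simp [centredIndicator, Set.indicator, h]
  have hcond : P[fun ω => centredIndicator j (i (t + s) ω) | pastSigma i t] =ᵐ[P]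
      fun ω => Real.exp (-(N * γ * s)) * centredIndicator j (i t ω) := by
    rw [heq]
    filter_upwards [condExp_sub hind (integrable_const (1 / N : ℝ)) (pastSigma i t),
      hi.markov t s j] with ω h1 h2
    rw [h1, Pi.sub_apply, h2, condExp_const hm, exp_smul_rateMatrix]
    ring
  have hpull := condExp_stronglyMeasurable_mul_of_bound hm hf (hb (t + s)) 1
    (ae_of_all _ fun ω => abs_centredIndicator_le_one _ _)
  calc _ = ∫ ω, (P[(fun ω => centredIndicator j (i t ω)) *
        (fun ω => centredIndicator j (i (t + s) ω)) | pastSigma i t]) ω ∂P :=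
        (integral_condExp hm).symm
    _ = ∫ ω, Real.exp (-(N * γ * s)) * centredIndicator j (i t ω) ^ 2 ∂P := by
        refine integral_congr_ae ?_
        filter_upwards [hpull, hcond] with ω h1 h2
        rw [h1, Pi.mul_apply, h2]
        ring
    _ = _ := integral_const_mul _ _

lemma IsIndexProcess.abs_integral_centredIndicator_mul_le {Ω : Type*} [MeasurableSpace Ω]
    {P : Measure Ω} [IsProbabilityMeasure P] {N : ℕ} [NeZero N] {γ : ℝ} {i : ℝ≥0 → Ω → Fin N}
    (hi : IsIndexProcess P γ i) (t s : ℝ≥0) (j : Fin N) :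
    |∫ ω, centredIndicator j (i t ω) * centredIndicator j (i s ω) ∂P| ≤
      Real.exp (-(N * γ * |(s : ℝ) - t|)) := by
  wlog hts : t ≤ s generalizing s t
  · simp_rw [mul_comm (centredIndicator j (i t _)), abs_sub_comm (s : ℝ)]
    exact this s t (le_of_not_ge hts)
  obtain ⟨u, rfl⟩ := exists_add_of_le hts
  rw [hi.integral_centredIndicator_mul]
  have h : |∫ ω, centredIndicator j (i t ω) ^ 2 ∂P| ≤ 1 := by
    have := norm_integral_le_of_norm_le_const (μ := P) (C := 1)
      (f := fun ω => centredIndicator j (i t ω) ^ 2) (ae_of_all _ fun ω => by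
        rw [norm_pow]
        exact pow_le_one₀ (norm_nonneg _) (abs_centredIndicator_le_one _ _))
    simpa using this
  have hu : |((t + u : ℝ≥0) : ℝ) - t| = u := by
    push_cast
    rw [add_sub_cancel_left, NNReal.abs_eq]
  rw [abs_mul, abs_of_pos (Real.exp_pos _), hu]
  exact mul_le_of_le_one_right (Real.exp_pos _).le h

/-! ### Averaging -/

section Averaging

variable {Ω ι E : Type*} [MeasurableSpace Ω] {P : Measure Ω} [IsProbabilityMeasure P]
  [NormedAddCommGroup E] {l : Filter ι}

/-! ### Mean-square estimates from covariances -/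

section InnerProduct

variable [InnerProductSpace ℝ E] {α : Type*} [MeasurableSpace α] {μ : Measure α}

lemma integrable_bounded_smul {h : α → ℝ} (hm : Measurable h) (hb : ∀ s, |h s| ≤ 1) {G : α → E}
    (hG : Integrable G μ) : Integrable (fun s => h s • G s) μ := by
  refine hG.norm.mono' (hm.aestronglyMeasurable.smul hG.1) (ae_of_all _ fun s => ?_)
  rw [norm_smul]
  exact mul_le_of_le_one_left (norm_nonneg _) (hb s)

lemma norm_integral_bounded_smul_le {h : α → ℝ} (hb : ∀ s, |h s| ≤ 1) {G : α → E}
    (hG : Integrable G μ) : ‖∫ s, h s • G s ∂μ‖ ≤ ∫ s, ‖G s‖ ∂μ := by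
  refine norm_integral_le_of_norm_le hG.norm (ae_of_all _ fun s => ?_)
  rw [norm_smul]
  exact mul_le_of_le_one_left (norm_nonneg _) (hb s)

variable [SFinite μ]

lemma integrable_bounded_mul_inner {β : Type*} [MeasurableSpace β] {Q : Measure β} [IsFiniteMeasure Q]
    {h : α → β → ℝ} (hm : Measurable (Function.uncurry h))
    (hb : ∀ s b, |h s b| ≤ 1) {G : α → E} (hG : Integrable G μ) :
    Integrable (fun q : β × (α × α) =>
      h q.2.1 q.1 * h q.2.2 q.1 * inner ℝ (G q.2.1) (G q.2.2)) (Q.prod (μ.prod μ)) := by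
  have hdom : Integrable (fun p : α × α => ‖G p.1‖ * ‖G p.2‖) (μ.prod μ) :=
    hG.norm.mul_prod hG.norm
  have h1 : Measurable fun q : β × (α × α) => h q.2.1 q.1 :=
    hm.comp ((measurable_fst.comp measurable_snd).prodMk measurable_fst)
  have h2 : Measurable fun q : β × (α × α) => h q.2.2 q.1 :=
    hm.comp ((measurable_snd.comp measurable_snd).prodMk measurable_fst)
  have h3 : AEStronglyMeasurable (fun p : α × α => (inner ℝ (G p.1) (G p.2) : ℝ)) (μ.prod μ) :=
    hG.1.comp_fst.inner hG.1.comp_snd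
  refine (hdom.comp_snd Q).mono' ((h1.mul h2).aestronglyMeasurable.mul h3.comp_snd)
    (ae_of_all _ fun q => ?_)
  rw [norm_mul, norm_mul]
  refine (mul_le_of_le_one_left (norm_nonneg _) ?_).trans (norm_inner_le_norm _ _)
  exact mul_le_one₀ (hb _ _) (norm_nonneg _) (hb _ _)

variable [CompleteSpace E]

lemma norm_sq_integral_smul_eq {h : α → ℝ} (hm : Measurable h) (hb : ∀ s, |h s| ≤ 1) {G : α → E}
    (hG : Integrable G μ) :
    ‖∫ s, h s • G s ∂μ‖ ^ 2 = ∫ p, h p.1 * h p.2 * inner ℝ (G p.1) (G p.2) ∂(μ.prod μ) := by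
  have hi := integrable_bounded_smul hm hb hG
  have hprod : Integrable (fun p : α × α => h p.1 * h p.2 * inner ℝ (G p.1) (G p.2))
      (μ.prod μ) := by
    -- A one-point probability space turns the random bound into the deterministic one.
    have h1 := integrable_bounded_mul_inner (Q := Measure.dirac ()) (h := fun s (_ : Unit) => h s)
      (hm.comp measurable_fst) (fun s _ => hb s) hG
    obtain ⟨_, h2⟩ := ((integrable_prod_iff h1.1).1 h1).1.exists
    exact h2
  rw [integral_prod _ hprod, ← real_inner_self_eq_norm_sq]
  rw [← integral_inner hi]
  refine integral_congr_ae (ae_of_all _ fun s => ?_)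
  simp only
  rw [real_inner_comm, ← integral_inner hi]
  refine integral_congr_ae (ae_of_all _ fun r => ?_)
  simp only [real_inner_smul_left, real_inner_smul_right]
  ring

/-- If the covariances of a bounded process vanish asymptotically, so do its weighted
averages in mean square. -/
lemma tendsto_integral_norm_sq_of_tendsto_covariance [l.IsCountablyGenerated]
    {h : ι → α → Ω → ℝ}
    (hm : ∀ ν, Measurable (Function.uncurry (h ν))) (hb : ∀ ν s ω, |h ν s ω| ≤ 1) {G : α → E}
    (hG : Integrable G μ)
    (hcov : ∀ᵐ p ∂(μ.prod μ), Tendsto (fun ν => ∫ ω, h ν p.1 ω * h ν p.2 ω ∂P) l (𝓝 0)) :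
    Tendsto (fun ν => ∫ ω, ‖∫ s, h ν s ω • G s ∂μ‖ ^ 2 ∂P) l (𝓝 0) := by
  have hdom : Integrable (fun p : α × α => ‖G p.1‖ * ‖G p.2‖) (μ.prod μ) :=
    hG.norm.mul_prod hG.norm
  have heq : ∀ ν, ∫ ω, ‖∫ s, h ν s ω • G s ∂μ‖ ^ 2 ∂P =
      ∫ p, (∫ ω, h ν p.1 ω * h ν p.2 ω ∂P) * inner ℝ (G p.1) (G p.2) ∂(μ.prod μ) := by
    intro ν
    have h1 : ∀ ω, Measurable fun s => h ν s ω := fun ω =>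
      (hm ν).comp (measurable_id.prodMk measurable_const)
    simp_rw [fun ω => norm_sq_integral_smul_eq (h1 ω) (fun s => hb ν s ω) hG]
    rw [integral_integral_swap (integrable_bounded_mul_inner (Q := P) (hm ν) (hb ν) hG)]
    simp_rw [integral_mul_const]
  simp_rw [heq]
  have h0 : ∫ _ : α × α, (0 : ℝ) ∂(μ.prod μ) = 0 := by simp
  rw [← h0]
  refine tendsto_integral_filter_of_dominated_convergence (fun p : α × α => ‖G p.1‖ * ‖G p.2‖)
    (Eventually.of_forall fun ν => ?_) (Eventually.of_forall fun ν => ae_of_all _ fun p => ?_)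
    hdom ?_
  · have := (integrable_bounded_mul_inner (Q := P) (hm ν) (hb ν) hG).swap.integral_prod_left.1
    simpa only [Function.comp_def, Prod.fst_swap, Prod.snd_swap, Prod.swap_prod_mk,
      integral_mul_const] using this
  · rw [norm_mul]
    refine (mul_le_of_le_one_left (norm_nonneg _) ?_).trans (norm_inner_le_norm _ _)
    have := norm_integral_le_of_norm_le_const (μ := P) (C := 1)
      (f := fun ω => h ν p.1 ω * h ν p.2 ω) (ae_of_all _ fun ω => by
        rw [norm_mul]
        exact mul_le_one₀ (hb _ _ _) (norm_nonneg _) (hb _ _ _))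
    simpa using this
  · filter_upwards [hcov] with p hp
    simpa using hp.mul_const (inner ℝ (G p.1) (G p.2))

/-- Chebyshev's inequality applied to the mean-square limit. -/
lemma tendsto_measureReal_of_tendsto_covariance [l.IsCountablyGenerated]
    {h : ι → α → Ω → ℝ}
    (hm : ∀ ν, Measurable (Function.uncurry (h ν))) (hb : ∀ ν s ω, |h ν s ω| ≤ 1) {G : α → E}
    (hG : Integrable G μ)
    (hcov : ∀ᵐ p ∂(μ.prod μ), Tendsto (fun ν => ∫ ω, h ν p.1 ω * h ν p.2 ω ∂P) l (𝓝 0))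
    {ε : ℝ} (hε : 0 < ε) :
    Tendsto (fun ν => P.real {ω | ε ≤ ‖∫ s, h ν s ω • G s ∂μ‖}) l (𝓝 0) := by
  have h1 := tendsto_integral_norm_sq_of_tendsto_covariance (P := P) hm hb hG hcov
  refine squeeze_zero (fun ν => measureReal_nonneg) (fun ν => ?_)
    (by simpa using h1.div_const (ε ^ 2))
  have hsm : AEStronglyMeasurable (fun ω => ∫ s, h ν s ω • G s ∂μ) P :=
    AEStronglyMeasurable.integral_prod_right' (f := fun q : Ω × α => h ν q.2 q.1 • G q.2)
      (((hm ν).comp measurable_swap).aestronglyMeasurable.smul hG.1.comp_snd)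
  have hint : Integrable (fun ω => ‖∫ s, h ν s ω • G s ∂μ‖ ^ 2) P := by
    refine Integrable.of_bound (hsm.norm.pow 2) ((∫ s, ‖G s‖ ∂μ) ^ 2) (ae_of_all _ fun ω => ?_)
    rw [norm_pow, norm_norm]
    exact pow_le_pow_left₀ (norm_nonneg _) (norm_integral_bounded_smul_le (fun s => hb ν s ω) hG) 2
  have h2 := mul_meas_ge_le_integral_of_nonneg (ae_of_all _ fun ω => by positivity) hint (ε ^ 2)
  rw [le_div_iff₀ (by positivity), mul_comm]
  refine le_trans (mul_le_mul_of_nonneg_left (measureReal_mono fun ω hω => ?_) (by positivity)) h2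
  exact pow_le_pow_left₀ hε.le hω 2

end InnerProduct

/-- Convergence in probability at every time of equi-Lipschitz processes is locally uniform. -/
lemma tendsto_measureReal_exists_ge {M : ι → ℝ → Ω → E} {T B : ℝ}
    (hM : ∀ t, 0 ≤ t → ∀ ε, 0 < ε → Tendsto (fun ν => P.real {ω | ε ≤ ‖M ν t ω‖}) l (𝓝 0))
    (hLip : ∀ ν ω, ∀ s ∈ Set.Icc 0 T, ∀ t ∈ Set.Icc 0 T, s ≤ t →
      ‖M ν t ω - M ν s ω‖ ≤ B * (t - s)) {ε : ℝ} (hε : 0 < ε) :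
    Tendsto (fun ν => P.real {ω | ∃ t ∈ Set.Icc 0 T, ε ≤ ‖M ν t ω‖}) l (𝓝 0) := by
  -- With mesh $1/n$, $M$ changes by less than $\varepsilon/2$ between grid points, so a value of
  -- norm at least $\varepsilon$ forces one of at least $\varepsilon/2$ at the grid point to its
  -- left.
  obtain ⟨n, hn⟩ := exists_nat_gt (2 * (|B| + 1) / ε)
  have hn0 : (0 : ℝ) < n := lt_of_le_of_lt (by positivity) hn
  have hsum : Tendsto (fun ν => ∑ k ∈ Finset.range (⌊n * T⌋₊ + 1),
      P.real {ω | ε / 2 ≤ ‖M ν (k / n) ω‖}) l (𝓝 0) := by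
    have := tendsto_finsetSum (Finset.range (⌊n * T⌋₊ + 1)) fun k _ =>
      hM ((k : ℝ) / n) (by positivity) (ε / 2) (by positivity)
    simpa using this
  refine squeeze_zero (fun ν => measureReal_nonneg) (fun ν => ?_) hsum
  refine (measureReal_mono ?_ (measure_ne_top _ _)).trans (measureReal_biUnion_finset_le _ _)
  rintro ω ⟨t, ht, hω⟩
  have hnt : 0 ≤ n * t := mul_nonneg hn0.le ht.1
  have hs0 : 0 ≤ (⌊n * t⌋₊ : ℝ) / n := by positivity
  have hs1 : (⌊n * t⌋₊ : ℝ) / n ≤ t := by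
    rw [div_le_iff₀ hn0, mul_comm t]; exact Nat.floor_le hnt
  have hs2 : t - (⌊n * t⌋₊ : ℝ) / n ≤ 1 / n := by
    rw [sub_le_iff_le_add, ← add_div, le_div_iff₀ hn0, mul_comm, add_comm]
    exact (Nat.lt_floor_add_one _).le
  refine Set.mem_biUnion (x := ⌊n * t⌋₊) ?_ ?_
  · simp only [Finset.coe_range, Set.mem_Iio, Nat.lt_succ_iff]
    exact Nat.floor_le_floor (mul_le_mul_of_nonneg_left ht.2 hn0.le)
  · have h1 := hLip ν ω _ ⟨hs0, hs1.trans ht.2⟩ t ht hs1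
    have h2 : B * (t - (⌊n * t⌋₊ : ℝ) / n) ≤ (|B| + 1) * (1 / n) :=
      mul_le_mul ((le_abs_self B).trans (by linarith)) hs2 (by linarith) (by positivity)
    have h3 : (|B| + 1) * (1 / n) < ε / 2 := by
      rw [mul_one_div, div_lt_iff₀ hn0]
      rw [div_lt_iff₀ hε] at hn
      linarith
    have h4 := norm_sub_norm_le (M ν t ω) (M ν (⌊n * t⌋₊ / n) ω)
    change ε / 2 ≤ ‖M ν (⌊n * t⌋₊ / n) ω‖
    linarith

end Averaging

/-! ### Averaging for switched Lipschitz systems -/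

section SwitchedSystem

variable {E : Type*} [NormedAddCommGroup E] {N : ℕ}

lemma sum_centredIndicator_smul [NormedSpace ℝ E] (G : Fin N → E) (k : Fin N) :
    ∑ j, centredIndicator j k • G j = G k - (1 / N : ℝ) • ∑ j, G j := by
  simp [centredIndicator, sub_smul, Finset.sum_sub_distrib, Finset.smul_sum]

lemma measurable_centredIndicator (j : Fin N) : Measurable (centredIndicator j) :=
  measurable_from_top

lemma intervalIntegrable_centredIndicator_smul [NormedSpace ℝ E] {J : ℝ → Fin N}
    (hJ : Measurable J) (j : Fin N) {G : ℝ → E} (hG : Continuous G) (a b : ℝ) :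
    IntervalIntegrable (fun s => centredIndicator j (J s) • G s) volume a b := by
  refine (hG.norm.intervalIntegrable a b).mono_fun
    (((measurable_centredIndicator j).comp hJ).aestronglyMeasurable.smul
      hG.aestronglyMeasurable) (ae_of_all _ fun s => ?_)
  simp only [norm_norm, norm_smul]
  exact mul_le_of_le_one_left (norm_nonneg _) (abs_centredIndicator_le_one _ _)

/-- Solutions of the switched system are close to those of the averaged system as soon as the
averaging error along the averaged solution is small. -/
lemma norm_sub_le_of_averaging_error [NormedSpace ℝ E] {V : Fin N → E → E} {C : ℝ≥0}
    (hV : ∀ j, LipschitzWith C (V j)) {J : ℝ → Fin N} (hJ : Measurable J) {x : E} {y z : ℝ → E}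
    (hy : Continuous y) (hz : Continuous z)
    (hysol : ∀ t, 0 ≤ t → y t = x + ∫ s in (0 : ℝ)..t, V (J s) (y s))
    (hzsol : ∀ t, 0 ≤ t → z t = x + ∫ s in (0 : ℝ)..t, (1 / N : ℝ) • ∑ j, V j (z s))
    {T δ : ℝ} (hδ : ∀ t ∈ Set.Icc 0 T,
      ‖∑ j, ∫ s in (0 : ℝ)..t, centredIndicator j (J s) • V j (z s)‖ ≤ δ) :
    ∀ t ∈ Set.Icc 0 T, ‖y t - z t‖ ≤ δ * Real.exp (C * t) := by
  have hVc : ∀ j, Continuous (V j) := fun j => (hV j).continuous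
  refine le_mul_exp_of_le_add_mul_integral (hy.sub hz).norm (fun t => norm_nonneg _) C.2
    fun t ht => ?_
  have hiy := intervalIntegrable_switching hVc hJ hy 0 t
  have hiz := intervalIntegrable_switching hVc hJ hz 0 t
  have hic : IntervalIntegrable (fun s => (1 / N : ℝ) • ∑ j, V j (z s)) volume 0 t :=
    Continuous.intervalIntegrable
      ((continuous_finsetSum _ fun j _ => (hVc j).comp hz).const_smul _) _ _
  have h1 : y t - z t = (∑ j, ∫ s in (0 : ℝ)..t, centredIndicator j (J s) • V j (z s)) +
      ∫ s in (0 : ℝ)..t, (V (J s) (y s) - V (J s) (z s)) := by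
    have hij := fun j => intervalIntegrable_centredIndicator_smul (G := fun s => V j (z s)) hJ j
      ((hVc j).comp hz) 0 t
    rw [← intervalIntegral.integral_finsetSum fun j _ => hij j]
    simp_rw [sum_centredIndicator_smul]
    rw [intervalIntegral.integral_sub hiz hic, intervalIntegral.integral_sub hiy hiz,
      hysol t ht.1, hzsol t ht.1]
    abel
  simp only [Pi.sub_apply]
  rw [h1]
  refine (norm_add_le _ _).trans (add_le_add (hδ t ht) ?_)
  rw [← intervalIntegral.integral_const_mul]
  refine intervalIntegral.norm_integral_le_of_norm_le ht.1 (ae_of_all _ fun s _ => ?_)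
    (Continuous.intervalIntegrable (by fun_prop) _ _)
  rw [← dist_eq_norm, ← dist_eq_norm]
  exact (hV _).dist_le_mul _ _

lemma tendsto_measureReal_averaging_error [InnerProductSpace ℝ E] [CompleteSpace E]
    {Ω ι : Type*} [MeasurableSpace Ω] {P : Measure Ω} [IsProbabilityMeasure P] {l : Filter ι}
    [l.IsCountablyGenerated] {J : ι → ℝ → Ω → Fin N} (hJ : ∀ ν, Measurable (Function.uncurry (J ν)))
    (hcov : ∀ j s r, 0 < s → 0 < r → s ≠ r → Tendsto (fun ν => ∫ ω,
      centredIndicator j (J ν s ω) * centredIndicator j (J ν r ω) ∂P) l (𝓝 0))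
    {G : Fin N → ℝ → E} (hG : ∀ j, Continuous (G j)) (T : ℝ) {ε : ℝ} (hε : 0 < ε) :
    Tendsto (fun ν => P.real {ω | ∃ t ∈ Set.Icc 0 T,
      ε ≤ ‖∑ j, ∫ s in (0 : ℝ)..t, centredIndicator j (J ν s ω) • G j s‖}) l (𝓝 0) := by
  have hJω : ∀ ν ω, Measurable fun s => J ν s ω := fun ν ω =>
    (hJ ν).comp (measurable_id.prodMk measurable_const)
  have hGs : Continuous fun s => ∑ j, ‖G j s‖ := continuous_finsetSum _ fun j _ => (hG j).norm
  obtain ⟨B, hB⟩ := (isCompact_Icc (a := 0) (b := T)).exists_bound_of_continuousOn hGs.continuousOn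
  refine tendsto_measureReal_exists_ge (B := B) (fun t ht ε hε => ?_) (fun ν ω s hs t ht hst => ?_)
    hε
  -- Covariances need not vanish on the diagonal, but it is null for the product measure.
  · have hne : ∀ᵐ p ∂((volume.restrict (Set.Ioc 0 t)).prod (volume.restrict (Set.Ioc 0 t))),
        (0 < p.1 ∧ 0 < p.2) ∧ p.1 ≠ p.2 := by
      refine Filter.Eventually.and ?_ ?_
      · rw [Measure.prod_restrict]
        filter_upwards [ae_restrict_mem (measurableSet_Ioc.prod measurableSet_Ioc)] with p hp
        exact ⟨hp.1.1, hp.2.1⟩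
      · have hd : MeasurableSet {p : ℝ × ℝ | p.1 = p.2} :=
          measurableSet_eq_fun measurable_fst measurable_snd
        refine ae_iff.2 ?_
        simp only [ne_eq, not_not]
        rw [Measure.measure_prod_null hd]
        refine ae_of_all _ fun s => ?_
        have : Prod.mk s ⁻¹' {p : ℝ × ℝ | p.1 = p.2} = {s} := by
          ext r; simp [eq_comm]
        simp only [this]
        simp
    -- If the sum of $N$ vectors has norm at least $\varepsilon$, some summand has norm at least
    -- $\varepsilon/N$.
    have hone : ∀ j, Tendsto (fun ν => P.real {ω | ε / N ≤
        ‖∫ s in (0 : ℝ)..t, centredIndicator j (J ν s ω) • G j s‖}) l (𝓝 0) := by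
      intro j
      have hN : (0 : ℝ) < N := by exact_mod_cast j.pos
      simp_rw [intervalIntegral.integral_of_le ht]
      refine tendsto_measureReal_of_tendsto_covariance
        (h := fun ν s ω => centredIndicator j (J ν s ω))
        (fun ν => (measurable_centredIndicator j).comp (hJ ν))
        (fun ν s ω => abs_centredIndicator_le_one _ _)
        ((hG j).integrableOn_Ioc) ?_ (by positivity)
      filter_upwards [hne] with p hp
      exact hcov j p.1 p.2 hp.1.1 hp.1.2 hp.2
    have hsum := tendsto_finsetSum Finset.univ fun j _ => hone j
    rw [Finset.sum_const_zero] at hsum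
    refine squeeze_zero (fun ν => measureReal_nonneg) (fun ν => ?_) hsum
    refine (measureReal_mono (fun ω hω => ?_) (measure_ne_top _ _)).trans
      (measureReal_biUnion_finset_le _ _)
    simp only [Finset.mem_univ, Set.iUnion_true, Set.mem_iUnion]
    by_contra! hcon
    rcases N.eq_zero_or_pos with rfl | hN
    · have h0 : ε ≤ 0 := by simpa using hω
      exact absurd hε h0.not_gt
    have hN' : (0 : ℝ) < N := by exact_mod_cast hN
    have : Nonempty (Fin N) := ⟨⟨0, hN⟩⟩
    have hlt : ∑ j : Fin N, ‖∫ s in (0 : ℝ)..t, centredIndicator j (J ν s ω) • G j s‖ <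
        ∑ _ : Fin N, ε / N :=
      Finset.sum_lt_sum_of_nonempty Finset.univ_nonempty fun j _ => not_le.1 (hcon j)
    have hle : ε ≤ _ := le_trans hω (norm_sum_le _ _)
    have heq : ∑ _ : Fin N, ε / N = ε := by
      simp; field_simp
    linarith
  · have hii : ∀ j a b, IntervalIntegrable (fun s => centredIndicator j (J ν s ω) • G j s)
        volume a b := fun j a b =>
      intervalIntegrable_centredIndicator_smul (hJω ν ω) j (hG j) a b
    rw [← Finset.sum_sub_distrib]
    simp_rw [fun j => intervalIntegral.integral_interval_sub_left (hii j 0 t) (hii j 0 s)]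
    rw [← intervalIntegral.integral_finsetSum fun j _ => hii j s t]
    have := intervalIntegral.norm_integral_le_of_norm_le_const (a := s) (b := t) (C := B)
      (f := fun u => ∑ j, centredIndicator j (J ν u ω) • G j u) (fun u hu => by
        rw [Set.uIoc_of_le hst] at hu
        refine (norm_sum_le _ _).trans (le_trans (Finset.sum_le_sum fun j _ => ?_)
          ((le_abs_self _).trans (hB u ⟨hs.1.trans hu.1.le, hu.2.trans ht.2⟩)))
        rw [norm_smul]
        exact mul_le_of_le_one_left (norm_nonneg _) (abs_centredIndicator_le_one _ _))
    rwa [abs_of_nonneg (sub_nonneg.2 hst)] at this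

end SwitchedSystem

/-- Speeding time up by $1/\nu$ stretches the gap between distinct times to $|r-s|/\nu\to\infty$. -/
lemma IsIndexProcess.tendsto_covariance {Ω : Type*} [MeasurableSpace Ω]
    {P : Measure Ω} [IsProbabilityMeasure P] {N : ℕ} [NeZero N] {γ : ℝ} (hγ : 0 < γ)
    {i : ℝ≥0 → Ω → Fin N} (hi : IsIndexProcess P γ i) (j : Fin N) {s r : ℝ} (hs : 0 < s)
    (hr : 0 < r) (hsr : s ≠ r) :
    Tendsto (fun ν : ℝ≥0 => ∫ ω, centredIndicator j (i (s.toNNReal / ν) ω) *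
      centredIndicator j (i (r.toNNReal / ν) ω) ∂P) (𝓝[>] 0) (𝓝 0) := by
  have hN : (0 : ℝ) < N := by exact_mod_cast NeZero.pos N
  have hc : 0 < N * γ * |r - s| := by
    have := abs_pos.2 (sub_ne_zero.2 hsr.symm)
    positivity
  have hinv : Tendsto (fun ν : ℝ≥0 => N * γ * |r - s| * (ν : ℝ)⁻¹) (𝓝[>] 0) atTop := by
    refine Tendsto.const_mul_atTop hc (tendsto_inv_nhdsGT_zero.comp ?_)
    refine tendsto_nhdsWithin_iff.2 ⟨?_, ?_⟩
    · exact (NNReal.continuous_coe.tendsto' 0 0 rfl).mono_left nhdsWithin_le_nhds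
    · filter_upwards [self_mem_nhdsWithin] with ν hν
      exact hν
  refine squeeze_zero_norm (fun ν => ?_) (Real.tendsto_exp_neg_atTop_nhds_zero.comp hinv)
  refine (hi.abs_integral_centredIndicator_mul_le _ _ j).trans (le_of_eq ?_)
  have h : |((r.toNNReal / ν : ℝ≥0) : ℝ) - (s.toNNReal / ν : ℝ≥0)| = |r - s| * (ν : ℝ)⁻¹ := by
    rw [NNReal.coe_div, NNReal.coe_div, Real.coe_toNNReal _ hs.le, Real.coe_toNNReal _ hr.le,
      ← sub_div, abs_div, NNReal.abs_eq, div_eq_mul_inv]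
  rw [h, Function.comp_apply, mul_assoc (N * γ)]

/-! ### The underdamped dynamics in phase space -/

section PhaseSpace

variable {K N : ℕ}

/-- The vector field `(q, p) ↦ (p, -∇Φ_j(q) - α p)` on phase space. -/
noncomputable def momentumField (Φ : Fin N → XSpace K → ℝ) (α : ℝ) (j : Fin N)
    (x : PhaseSpace K) : PhaseSpace K :=
  WithLp.toLp 2 (x.snd, -∇ (Φ j) x.fst - α • x.snd)

lemma exists_lipschitzWith_momentumField {Φ : Fin N → XSpace K → ℝ} {L : ℝ≥0}
    (hL : ∀ j, LipschitzWith L (∇ (Φ j))) (α : ℝ) :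
    ∃ C : ℝ≥0, ∀ j, LipschitzWith C (momentumField Φ α j) := by
  have hfst : LipschitzWith (1 * 1) fun x : PhaseSpace K => x.fst :=
    LipschitzWith.prod_fst.comp (WithLp.prod_lipschitzWith_ofLp 2 _ _)
  have hsnd : LipschitzWith (1 * 1) fun x : PhaseSpace K => x.snd :=
    LipschitzWith.prod_snd.comp (WithLp.prod_lipschitzWith_ofLp 2 _ _)
  -- The composition rules determine the constant; it is the same for all $j$ because $L$ is.
  refine ⟨_, fun j => (WithLp.prod_lipschitzWith_toLp 2 _ _).comp (hsnd.prodMk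
    (((hL j).comp hfst).neg.sub ((lipschitzWith_smul α).comp hsnd)))⟩

lemma gradient_fullPotential {Φ : Fin N → XSpace K → ℝ} (hΦ : ∀ j, ContDiff ℝ 1 (Φ j))
    (x : XSpace K) : ∇ (fullPotential Φ) x = (1 / N : ℝ) • ∑ j, ∇ (Φ j) x := by
  have hd : ∀ j, DifferentiableAt ℝ (Φ j) x := fun j =>
    ((hΦ j).differentiable one_ne_zero).differentiableAt
  refine HasGradientAt.gradient ?_
  rw [hasGradientAt_iff_hasFDerivAt]
  have h := (HasFDerivAt.fun_sum (u := Finset.univ) fun j _ => (hd j).hasFDerivAt).const_mul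
    (1 / N : ℝ)
  have he : InnerProductSpace.toDual ℝ (XSpace K) ((1 / N : ℝ) • ∑ j, ∇ (Φ j) x) =
      (1 / N : ℝ) • ∑ j, fderiv ℝ (Φ j) x := by
    simp [gradient, map_sum]
  rw [he]
  exact h

lemma average_momentumField [NeZero N] {Φ : Fin N → XSpace K → ℝ}
    (hΦ : ∀ j, ContDiff ℝ 1 (Φ j)) (α : ℝ) (x : PhaseSpace K) :
    (1 / N : ℝ) • ∑ j, momentumField Φ α j x =
      WithLp.toLp 2 (x.snd, -∇ (fullPotential Φ) x.fst - α • x.snd) := by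
  have hN : (N : ℝ) ≠ 0 := NeZero.ne _
  rw [gradient_fullPotential hΦ]
  simp only [momentumField]
  rw [← WithLp.toLp_sum, ← WithLp.toLp_smul]
  congr 1
  refine Prod.ext ?_ ?_
  · rw [Prod.smul_fst, Prod.fst_sum]
    simp [← Nat.cast_smul_eq_nsmul ℝ, smul_smul, hN]
  · rw [Prod.smul_snd, Prod.snd_sum]
    simp [← Nat.cast_smul_eq_nsmul ℝ, smul_smul, hN, Finset.sum_sub_distrib, smul_sub]

lemma phaseSpace_eq_add_integral {g : ℝ → PhaseSpace K} {t : ℝ}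
    (hg : IntervalIntegrable g volume 0 t) {x : PhaseSpace K} {q₀ p₀ : XSpace K}
    (hq : x.fst = q₀ + ∫ s in (0 : ℝ)..t, (g s).fst)
    (hp : x.snd = p₀ + ∫ s in (0 : ℝ)..t, (g s).snd) :
    x = WithLp.toLp 2 (q₀, p₀) + ∫ s in (0 : ℝ)..t, g s := by
  have h1 := (WithLp.fstL 2 ℝ (XSpace K) (XSpace K)).intervalIntegral_comp_comm hg
  have h2 := (WithLp.sndL 2 ℝ (XSpace K) (XSpace K)).intervalIntegral_comp_comm hg
  simp only [WithLp.fstL_apply, WithLp.sndL_apply] at h1 h2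
  refine WithLp.ofLp_injective 2 (Prod.ext ?_ ?_)
  · change x.fst = q₀ + (∫ s in (0 : ℝ)..t, g s).fst
    rw [hq, h1]
  · change x.snd = p₀ + (∫ s in (0 : ℝ)..t, g s).snd
    rw [hp, h2]

lemma continuous_path_toNNReal (z : PathSpace K) : Continuous fun s : ℝ => z s.toNNReal :=
  (map_continuous z).comp continuous_real_toNNReal

lemma IsMomentumPath.eq_add_integral {Φ : Fin N → XSpace K → ℝ} {α : ℝ}
    (hV : ∀ j, Continuous (momentumField Φ α j)) {q₀ p₀ : XSpace K} {j : ℝ≥0 → Fin N}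
    (hj : Measurable j) {z : PathSpace K} (hz : IsMomentumPath Φ α 1 q₀ p₀ j z) {t : ℝ}
    (ht : 0 ≤ t) :
    z t.toNNReal = WithLp.toLp 2 (q₀, p₀) +
      ∫ s in (0 : ℝ)..t, momentumField Φ α (j s.toNNReal) (z s.toNNReal) := by
  refine phaseSpace_eq_add_integral (intervalIntegrable_switching hV
    (hj.comp measurable_real_toNNReal) (continuous_path_toNNReal z) 0 t) ?_ ?_
  · have := hz.pos_eq t.toNNReal
    rwa [Real.coe_toNNReal _ ht] at this
  · have := hz.vel_eq t.toNNReal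
    rwa [Real.coe_toNNReal _ ht, one_smul, one_smul] at this

lemma IsUnderdampedGradientFlow.eq_add_integral [NeZero N] {Φ : Fin N → XSpace K → ℝ}
    (hΦ : ∀ j, ContDiff ℝ 1 (Φ j)) {α : ℝ}
    (hV : ∀ j, Continuous (momentumField Φ α j)) {q₀ p₀ : XSpace K}
    {z : PathSpace K} (hz : IsUnderdampedGradientFlow (fullPotential Φ) α q₀ p₀ z) {t : ℝ}
    (ht : 0 ≤ t) :
    z t.toNNReal = WithLp.toLp 2 (q₀, p₀) +
      ∫ s in (0 : ℝ)..t, (1 / N : ℝ) • ∑ j, momentumField Φ α j (z s.toNNReal) := by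
  have hzc := continuous_path_toNNReal z
  have hfst : Continuous fun x : PhaseSpace K => x.fst :=
    (WithLp.fstL 2 ℝ (XSpace K) (XSpace K)).continuous
  have hsnd : Continuous fun x : PhaseSpace K => x.snd :=
    (WithLp.sndL 2 ℝ (XSpace K) (XSpace K)).continuous
  have hg : Continuous fun s : ℝ => (1 / N : ℝ) • ∑ j, momentumField Φ α j (z s.toNNReal) :=
    Continuous.const_smul (continuous_finsetSum _ fun j _ => (hV j).comp hzc) (1 / N : ℝ)
  have hFTC : ∀ {f f' : ℝ → XSpace K}, Continuous f → Continuous f' →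
      (∀ u : ℝ≥0, HasDerivWithinAt f (f' u) (Set.Ici 0) u) →
      f t = f 0 + ∫ s in (0 : ℝ)..t, f' s := by
    intro f f' hf hf' hd
    rw [intervalIntegral.integral_eq_sub_of_hasDeriv_right_of_le ht hf.continuousOn
      (fun u hu => ?_) (hf'.intervalIntegrable _ _)]
    · abel
    · exact (hd ⟨u, hu.1.le⟩).mono (Set.Ioi_subset_Ici hu.1.le)
  refine phaseSpace_eq_add_integral (hg.intervalIntegrable 0 t) ?_ ?_
  · have := hFTC (hfst.comp hzc) (hfst.comp hg) fun u => by
      have h := hz.deriv_pos u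
      simp only [Function.comp_def, average_momentumField hΦ, Real.toNNReal_coe]
      exact h
    simpa only [Function.comp_def, Real.toNNReal_zero,
      show (z 0).fst = q₀ from hz.pos_zero] using this
  · have := hFTC (hsnd.comp hzc) (hsnd.comp hg) fun u => by
      have h := hz.deriv_vel u
      simp only [Function.comp_def, average_momentumField hΦ, Real.toNNReal_coe]
      exact h
    simpa only [Function.comp_def, Real.toNNReal_zero,
      show (z 0).snd = p₀ from hz.vel_zero] using this

end PhaseSpace

/-! ### Measurability and convergence of the stochastic gradient-momentum process -/

section GradientMomentum

variable {K N : ℕ} {Ω : Type*} [MeasurableSpace Ω] {P : Measure Ω}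
  {Φ : Fin N → XSpace K → ℝ} {α : ℝ} {q₀ p₀ : XSpace K}

lemma IsHSGMP.ae_eq_add_integral (hV : ∀ j, Continuous (momentumField Φ α j))
    {i i' : ℝ≥0 → Ω → Fin N} (hi' : Measurable (Function.uncurry i'))
    (hii' : ∀ᵐ ω ∂P, ∀ t, i' t ω = i t ω) {ν : ℝ≥0} {Z : Ω → PathSpace K}
    (hZ : IsHSGMP P Φ α 1 q₀ p₀ i ν Z) :
    ∀ᵐ ω ∂P, ∀ t : ℝ, 0 ≤ t → Z ω t.toNNReal = WithLp.toLp 2 (q₀, p₀) +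
      ∫ s in (0 : ℝ)..t, momentumField Φ α (i' (s.toNNReal / ν) ω) (Z ω s.toNNReal) := by
  filter_upwards [hZ, hii'] with ω hω hω' t ht
  have h : (fun t : ℝ≥0 => i (t / ν) ω) = fun t : ℝ≥0 => i' (t / ν) ω := by
    ext t; rw [hω']
  rw [h] at hω
  have hm : Measurable fun t : ℝ≥0 => i' (t / ν) ω :=
    hi'.comp ((measurable_id.div_const ν).prodMk measurable_const)
  exact hω.eq_add_integral hV hm ht

lemma measurable_timeChange {i : ℝ≥0 → Ω → Fin N} (hi : Measurable (Function.uncurry i))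
    (ν : ℝ≥0) : Measurable (Function.uncurry fun (s : ℝ) ω => i (s.toNNReal / ν) ω) :=
  hi.comp (((measurable_real_toNNReal.comp measurable_fst).div_const ν).prodMk measurable_snd)

lemma IsHSGMP.aemeasurable {C : ℝ≥0} (hV : ∀ j, LipschitzWith C (momentumField Φ α j))
    {i i' : ℝ≥0 → Ω → Fin N} (hi' : Measurable (Function.uncurry i'))
    (hii' : ∀ᵐ ω ∂P, ∀ t, i' t ω = i t ω) {ν : ℝ≥0} {Z : Ω → PathSpace K}
    (hZ : IsHSGMP P Φ α 1 q₀ p₀ i ν Z) : AEMeasurable Z P := by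
  classical
  rcases isEmpty_or_nonempty Ω with hΩ | ⟨⟨ω₀⟩⟩
  · exact (measurable_of_empty _).aemeasurable
  have hJ := measurable_timeChange hi' ν
  have hVc : ∀ j, Continuous (momentumField Φ α j) := fun j => (hV j).continuous
  have hsol := hZ.ae_eq_add_integral hVc hi' hii'
  obtain ⟨S, hS, hSm, hS0⟩ := exists_measurable_superset_of_null (ae_iff.1 hsol)
  -- On the null set any fixed path will do; `Z ω₀` is one at hand.
  refine ⟨fun ω => if ω ∈ S then Z ω₀ else Z ω, PathSpace.measurable_of_eval fun t => ?_, ?_⟩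
  · refine stronglyMeasurable_of_tendsto atTop
      (f := fun n ω => if ω ∈ S then Z ω₀ t else picardIterate (momentumField Φ α)
        (WithLp.toLp 2 (q₀, p₀)) (fun s ω => i' (s.toNNReal / ν) ω) n t ω)
      (fun n => StronglyMeasurable.ite hSm stronglyMeasurable_const
        (stronglyMeasurable_picardIterate hVc _ hJ n t)) (tendsto_pi_nhds.2 fun ω => ?_)
    by_cases hω : ω ∈ S
    · simpa only [hω, if_true] using tendsto_const_nhds
    · simp only [hω, if_false]
      have hsω := not_not.1 fun hcon => hω (hS hcon)
      have := tendsto_picardIterate (J := fun s ω => i' (s.toNNReal / ν) ω) hV _ hJ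
        (continuous_path_toNNReal (Z ω)) hsω t.2
      simpa only [NNReal.val_eq_coe, Real.toNNReal_coe] using this
  · filter_upwards [measure_eq_zero_iff_ae_notMem.1 hS0] with ω hω
    simp [hω]

lemma tendsto_measureReal_dist_hsgmp [IsProbabilityMeasure P] [NeZero N]
    (hΦ : ∀ j, ContDiff ℝ 1 (Φ j)) {C : ℝ≥0}
    (hV : ∀ j, LipschitzWith C (momentumField Φ α j)) {γ : ℝ} (hγ : 0 < γ)
    {i : ℝ≥0 → Ω → Fin N} (hi : IsIndexProcess P γ i)
    {Z : ℝ≥0 → Ω → PathSpace K} (hZ : ∀ ν : ℝ≥0, 0 < ν → IsHSGMP P Φ α 1 q₀ p₀ i ν (Z ν))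
    {z : PathSpace K} (hz : IsUnderdampedGradientFlow (fullPotential Φ) α q₀ p₀ z)
    {δ : ℝ} (hδ : 0 < δ) :
    Tendsto (fun ν => P.real {ω | δ ≤ dist (Z ν ω) z}) (𝓝[>] 0) (𝓝 0) := by
  obtain ⟨i', hi', hii'⟩ := hi.exists_rightContinuous
  have hVc : ∀ j, Continuous (momentumField Φ α j) := fun j => (hV j).continuous
  obtain ⟨T, hT⟩ := PathSpace.exists_forall_le_dist_lt z hδ
  -- Chosen so that the Gronwall factor $e^{CT}$ brings the error on $[0,T]$ to at most $\delta/3$.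
  have hε : 0 < δ / 3 * Real.exp (-(C * T)) := by positivity
  have hcov : ∀ (j : Fin N) (s r : ℝ), 0 < s → 0 < r → s ≠ r → Tendsto (fun ν : ℝ≥0 =>
      ∫ ω, centredIndicator j (i' (s.toNNReal / ν) ω) *
        centredIndicator j (i' (r.toNNReal / ν) ω) ∂P) (𝓝[>] 0) (𝓝 0) := by
    intro j s r hs hr hsr
    refine (hi.tendsto_covariance hγ j hs hr hsr).congr fun ν => integral_congr_ae ?_
    filter_upwards [hii'] with ω hω
    rw [hω, hω]
  have key := tendsto_measureReal_averaging_error (P := P) (l := 𝓝[>] (0 : ℝ≥0))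
    (J := fun ν s ω => i' (s.toNNReal / ν) ω) (measurable_timeChange hi') hcov
    (G := fun j s => momentumField Φ α j (z s.toNNReal))
    (fun j => (hVc j).comp (continuous_path_toNNReal z)) T hε
  refine squeeze_zero' (Eventually.of_forall fun ν => measureReal_nonneg) ?_ key
  filter_upwards [self_mem_nhdsWithin] with ν hν
  refine ENNReal.toReal_mono (measure_ne_top _ _) (measure_mono_ae ?_)
  filter_upwards [(hZ ν hν).ae_eq_add_integral hVc hi' hii'] with ω hsol (hω : δ ≤ _)
  by_contra hcon
  have hcon' : ∀ t ∈ Set.Icc (0 : ℝ) T, ‖∑ j, ∫ s in (0 : ℝ)..t,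
      centredIndicator j (i' (s.toNNReal / ν) ω) • momentumField Φ α j (z s.toNNReal)‖ ≤
        δ / 3 * Real.exp (-(C * T)) := fun t ht =>
    le_of_not_ge fun h => hcon ⟨t, ht, h⟩
  have hb := norm_sub_le_of_averaging_error hV
    ((measurable_timeChange hi' ν).comp (measurable_id.prodMk measurable_const))
    (continuous_path_toNNReal (Z ν ω)) (continuous_path_toNNReal z) hsol
    (fun t ht => hz.eq_add_integral hΦ hVc ht) hcon'
  refine hω.not_gt (hT _ fun s hs => ?_)
  have h1 := hb s ⟨s.2, hs⟩
  rw [Real.toNNReal_coe] at h1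
  refine h1.trans ?_
  rw [mul_assoc, ← Real.exp_add]
  refine mul_le_of_le_one_right (by positivity) (Real.exp_le_one_iff.2 ?_)
  have : (C : ℝ) * s ≤ C * T := mul_le_mul_of_nonneg_left hs C.2
  linarith

end GradientMomentum

/-! ### From convergence in probability to weak convergence -/

/-- Convergence in probability to a constant implies convergence of the expectations of bounded
continuous functionals. -/
lemma tendsto_integral_of_tendsto_measureReal_dist {Ω ι S : Type*} [MeasurableSpace Ω]
    {P : Measure Ω} [IsProbabilityMeasure P] [PseudoMetricSpace S] [MeasurableSpace S]
    [OpensMeasurableSpace S] {l : Filter ι} {Z : ι → Ω → S} {z : S}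
    (hZ : ∀ᶠ ν in l, AEMeasurable (Z ν) P)
    (h : ∀ δ, 0 < δ → Tendsto (fun ν => P.real {ω | δ ≤ dist (Z ν ω) z}) l (𝓝 0))
    (F : S →ᵇ ℝ) : Tendsto (fun ν => ∫ ω, F (Z ν ω) ∂P) l (𝓝 (F z)) := by
  rw [Metric.tendsto_nhds]
  intro ε hε
  obtain ⟨δ, hδ, hF⟩ := Metric.continuousAt_iff.1 (F.continuous.continuousAt (x := z)) (ε / 2)
    (by positivity)
  have h1 : Tendsto (fun ν => 2 * ‖F‖ * P.real {ω | δ ≤ dist (Z ν ω) z}) l (𝓝 0) := by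
    simpa using (h δ hδ).const_mul (2 * ‖F‖)
  filter_upwards [hZ, h1.eventually (gt_mem_nhds (show (0 : ℝ) < ε / 2 by positivity))]
    with ν hm hν
  have hnull : NullMeasurableSet {ω | δ ≤ dist (Z ν ω) z} P :=
    hm.nullMeasurable (isClosed_le continuous_const
      (continuous_id.dist continuous_const)).measurableSet
  have hFm : AEStronglyMeasurable (fun ω => F (Z ν ω)) P :=
    (F.continuous.measurable.comp_aemeasurable hm).aestronglyMeasurable
  have hFi : Integrable (fun ω => F (Z ν ω)) P :=
    Integrable.of_bound hFm ‖F‖ (ae_of_all _ fun ω => F.norm_coe_le_norm _)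
  -- The dominating function: continuity at `z` gives $\varepsilon/2$ near `z`, and boundedness
  -- gives $2\|F\|$ elsewhere.
  have hi : Integrable (fun ω => ε / 2 + {ω | δ ≤ dist (Z ν ω) z}.indicator
      (fun _ => 2 * ‖F‖) ω) P :=
    (integrable_const _).add ((integrable_const _).indicator₀ hnull)
  have heq : ∫ ω, F (Z ν ω) ∂P - F z = ∫ ω, (F (Z ν ω) - F z) ∂P := by
    rw [integral_sub hFi (integrable_const _)]
    simp
  rw [Real.dist_eq, heq, ← Real.norm_eq_abs]
  refine (norm_integral_le_of_norm_le hi (ae_of_all _ fun ω => ?_)).trans_lt ?_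
  · by_cases hω : δ ≤ dist (Z ν ω) z
    · rw [Set.indicator_of_mem (show ω ∈ {ω | δ ≤ dist (Z ν ω) z} from hω), ← dist_eq_norm]
      have := F.dist_le_two_norm (Z ν ω) z
      linarith
    · rw [Set.indicator_of_notMem (show ω ∉ {ω | δ ≤ dist (Z ν ω) z} from hω), add_zero,
        ← dist_eq_norm]
      exact (hF (not_le.1 hω)).le
  · rw [integral_add (integrable_const _) ((integrable_const _).indicator₀ hnull),
      integral_indicator₀ hnull]
    simp only [integral_const, smul_eq_mul, probReal_univ, one_mul, measureReal_restrict_apply_univ]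
    linarith

theorem mainTheorem5 {K N : ℕ} [NeZero N]
    {Ω : Type*} [MeasurableSpace Ω] (P : Measure Ω) [IsProbabilityMeasure P]
    (Φ : Fin N → XSpace K → ℝ) (L : ℝ≥0)
    (hΦ : ∀ j, ContDiff ℝ 1 (Φ j)) (hL : ∀ j, LipschitzWith L (∇ (Φ j)))
    (γ α : ℝ) (hγ : 0 < γ) (hα : 0 < α)
    (i : ℝ≥0 → Ω → Fin N) (hi : IsIndexProcess P γ i)
    (q₀ p₀ : XSpace K)
    (Z : ℝ≥0 → Ω → PathSpace K) (hZ : ∀ ν : ℝ≥0, 0 < ν → IsHSGMP P Φ α 1 q₀ p₀ i ν (Z ν))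
    (z : PathSpace K) (hz : IsUnderdampedGradientFlow (fullPotential Φ) α q₀ p₀ z) :
    (∀ ν : ℝ≥0, 0 < ν → AEMeasurable (Z ν) P) ∧
      ∀ F : PathSpace K →ᵇ ℝ,
        Tendsto (fun ν : ℝ≥0 => ∫ ω, F (Z ν ω) ∂P) (𝓝[>] 0) (𝓝 (F z)) := by
  obtain ⟨C, hV⟩ := exists_lipschitzWith_momentumField hL α
  obtain ⟨i', hi', hii'⟩ := hi.exists_rightContinuous
  have hm : ∀ ν : ℝ≥0, 0 < ν → AEMeasurable (Z ν) P := fun ν hν =>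
    (hZ ν hν).aemeasurable hV hi' hii'
  refine ⟨hm, tendsto_integral_of_tendsto_measureReal_dist ?_ fun δ hδ =>
    tendsto_measureReal_dist_hsgmp hΦ hV hγ hi hZ hz hδ⟩
  filter_upwards [self_mem_nhdsWithin] with ν hν
  exact hm ν hν
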